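/- Let $G$ be a finite group and let $\operatorname{Irr}(G)$ be the set of its irreducible complex characters. For $x\in G$ let $\mathbb{Q}(x)$ be the subfield of $\mathbb{C}$ generated over $\mathbb{Q}$ by $\{\psi(x) : \psi\in\operatorname{Irr}(G)\}$, and for $\chi\in\operatorname{Irr}(G)$ let $\mathbb{Q}(\chi)$ be the subfield of $\mathbb{C}$ generated over $\mathbb{Q}$ by $\{\chi(g) : g\in G\}$. The element $x$ is called rational if $\mathbb{Q}(x)=\mathbb{Q}$ and irrational otherwise; a conjugacy class of $G$ is called rational (respectively irrational) if its elements are rational (respectively irrational). The character $\chi$ is called rational if $\mathbb{Q}(\chi)=\mathbb{Q}$. If $G$ has at most $5$ irrational conjugacy classes, then the number of rational conjugacy classes of $G$ equals the number of rational irreducible characters of $G$. -/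

import Mathlib

namespace RatClass

/-- `Irr(G)`: the set of irreducible complex characters of `G`. Every finite-dimensional complex
representation is isomorphic to one on some `ℂⁿ`, and isomorphic representations have the same
character, so it suffices to consider representations on the spaces `Fin n → ℂ`. -/
def Irr (G : Type*) [Group G] : Set (G → ℂ) :=
  {χ | ∃ (n : ℕ) (ρ : Representation ℂ G (Fin n → ℂ)), ρ.IsIrreducible ∧ χ = ρ.character}

/-- The field `ℚ(x)` generated over `ℚ` by the values `ψ(x)`, `ψ ∈ Irr(G)`. -/
noncomputable def elementField {G : Type*} [Group G] (x : G) : IntermediateField ℚ ℂ :=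
  IntermediateField.adjoin ℚ {z : ℂ | ∃ ψ ∈ Irr G, z = ψ x}

/-- The field `ℚ(χ)` generated over `ℚ` by the values of `χ`. -/
noncomputable def characterField {G : Type*} [Group G] (χ : G → ℂ) : IntermediateField ℚ ℂ :=
  IntermediateField.adjoin ℚ (Set.range χ)

/-- `x` is rational if `ℚ(x) = ℚ`. -/
def IsRationalElement {G : Type*} [Group G] (x : G) : Prop :=
  elementField x = ⊥

/-- `cl_ℚ(G)`: the conjugacy classes consisting of rational elements. -/
def rationalClasses (G : Type*) [Group G] : Set (ConjClasses G) :=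
  {K | ∀ x ∈ K.carrier, IsRationalElement x}

/-- The irrational conjugacy classes: those consisting of irrational elements. -/
def irrationalClasses (G : Type*) [Group G] : Set (ConjClasses G) :=
  {K | ∀ x ∈ K.carrier, ¬ IsRationalElement x}

/-- `Irr_ℚ(G)`: the irreducible characters `χ` with `ℚ(χ) = ℚ`. -/
def rationalIrr (G : Type*) [Group G] : Set (G → ℂ) :=
  {χ | χ ∈ Irr G ∧ characterField χ = ⊥}

end RatClass

/-! Let A = Aut(ℂ) act on Irr(G) by χ ↦ σ ∘ χ, and on conjugacy classes by g ↦ g^k, where σ raises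
every |G|-th root of unity to the k-th power. Character values are sums of such roots, so σ(χ(g)) =
χ(g^k): the character table links the two actions, and rational characters and rational classes are
exactly the fixed points. By Brauer's permutation lemma (`ncard_fixedBy_eq_of_basis`) each single σ
fixes equally many classes and characters. Hence the claim holds whenever one σ has the same orbits
on classes as all of A.

A acts on classes through an abelian group. With at most five moved classes, the only obstruction to
finding such a σ is a single orbit of length four on which A acts as a Klein four-group
(`exists_zpow_smul_or_isKleinOrbit`).

In that case, suppose the two counts differ. Brauer's lemma then gives, for each of the three
involutions, an irrational character fixed by it. The difference between its conjugate under a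
second involution and itself vanishes on rational classes and is ±z on irrational ones.
Orthogonality makes its norm 2, so z² = ±2|G|/m, where m is the number of irrational elements
(`exists_eigenvalue_of_isKleinOrbit`). The three z have different sign patterns under the
four-group, so their squares are distinct, yet only two values are available. -/

/-! ### Automorphisms of an algebraically closed field -/

/-- An automorphism of a domain `R` extends to every algebraically closed field containing `R`. -/
theorem IsAlgClosed.exists_ringEquiv_extending {R K : Type*} [CommRing R] [IsDomain R] [Field K]
    [Algebra R K] [FaithfulSMul R K] [IsAlgClosed K] (φ : R ≃+* R) :
    ∃ σ : K ≃+* K, ∀ r : R, σ (algebraMap R K r) = algebraMap R K (φ r) := by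
  obtain ⟨s, hs⟩ := exists_isTranscendenceBasis R K
  let B := Algebra.adjoin R (Set.range ((↑) : s → K))
  have : Algebra.IsAlgebraic B K := hs.isAlgebraic
  have : IsAlgClosure B K := { isAlgClosed := inferInstance, isAlgebraic := hs.isAlgebraic }
  -- `B` is a polynomial ring over `R`, so `φ` can act on coefficients; `K` is an algebraic closure
  -- of `B`.
  let e : B ≃+* B := (hs.1.aevalEquiv.symm.toRingEquiv.trans (MvPolynomial.mapEquiv s φ)).trans
    hs.1.aevalEquiv.toRingEquiv
  refine ⟨IsAlgClosure.equivOfEquiv K K e, fun r => ?_⟩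
  have h := IsAlgClosure.equivOfEquiv_algebraMap K K e (algebraMap R B r)
  have he : e (algebraMap R B r) = algebraMap R B (φ r) := by
    have h1 : hs.1.aevalEquiv.symm (algebraMap R B r) = MvPolynomial.C r :=
      hs.1.aevalEquiv.symm.commutes r
    have h2 : hs.1.aevalEquiv (MvPolynomial.C (φ r)) = algebraMap R B (φ r) :=
      hs.1.aevalEquiv.commutes (φ r)
    change hs.1.aevalEquiv (MvPolynomial.map (φ : R →+* R)
      (hs.1.aevalEquiv.symm (algebraMap R B r))) = _
    rw [h1, MvPolynomial.map_C]
    exact h2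
  rw [he] at h
  exact h

/-- A complex number that is algebraic over `ℚ` and fixed by all automorphisms is rational. -/
theorem Complex.mem_bot_of_forall_ringEquiv_eq {z : ℂ} (hz : IsAlgebraic ℚ z)
    (h : ∀ σ : ℂ ≃+* ℂ, σ z = z) : z ∈ (⊥ : IntermediateField ℚ ℂ) := by
  let K := algebraicClosure ℚ ℂ
  have : IsAlgClosure ℚ K := algebraicClosure.isAlgClosure ℚ ℂ
  have : Normal ℚ K := IsAlgClosure.normal ℚ K
  have : IsGalois ℚ K := {}
  let z' : K := ⟨z, mem_algebraicClosure_iff.2 hz⟩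
  have hz' : z' ∈ (⊥ : IntermediateField ℚ K) := by
    rw [InfiniteGalois.mem_bot_iff_fixed]
    intro f
    obtain ⟨σ, hσ⟩ := IsAlgClosed.exists_ringEquiv_extending (K := ℂ) f.toRingEquiv
    have := hσ z'
    apply Subtype.ext
    exact this.symm.trans (h σ)
  obtain ⟨q, hq⟩ := IntermediateField.mem_bot.1 hz'
  exact IntermediateField.mem_bot.2 ⟨q, by simpa using congrArg (algebraMap K ℂ) hq⟩

/-- The traces of the powers of a complex endomorphism of finite order. -/
theorem LinearMap.exists_trace_pow_eq_sum {V : Type*} [AddCommGroup V] [Module ℂ V]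
    [FiniteDimensional ℂ V] {f : Module.End ℂ V} {N : ℕ} (hN : N ≠ 0) (hf : f ^ N = 1) :
    ∃ (s : Finset ℂ) (d : ℂ → ℕ), (∀ μ ∈ s, μ ^ N = 1) ∧
      ∀ k : ℕ, LinearMap.trace ℂ V (f ^ k) = ∑ μ ∈ s, d μ * μ ^ k := by
  -- `X ^ N - 1` is separable in characteristic zero, so `f` is diagonalizable.
  have hss : f.IsSemisimple := by
    refine Module.End.isSemisimple_of_squarefree_aeval_eq_zero
      (p := Polynomial.X ^ N - 1) ?_ (by simp [hf])
    have : (Polynomial.X ^ N - Polynomial.C (1 : ℂ)).Separable :=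
      Polynomial.separable_X_pow_sub_C 1 (by exact_mod_cast hN) one_ne_zero
    simpa using this.squarefree
  have hint : DirectSum.IsInternal f.eigenspace := by
    rw [DirectSum.isInternal_submodule_iff_iSupIndep_and_iSup_eq_top]
    refine ⟨f.eigenspaces_iSupIndep, ?_⟩
    exact hss.iSup_eigenspace_eq_top
  have hfin : {μ | f.eigenspace μ ≠ ⊥}.Finite :=
    WellFoundedGT.finite_ne_bot_of_iSupIndep f.eigenspaces_iSupIndep
  have hpow (k : ℕ) (μ : ℂ) (v : V) (hv : v ∈ f.eigenspace μ) : (f ^ k) v = μ ^ k • v := by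
    induction k with
    | zero => simp
    | succ k ih =>
      rw [pow_succ', Module.End.mul_apply, ih, map_smul, Module.End.mem_eigenspace_iff.1 hv,
        smul_smul, pow_succ]
  refine ⟨hfin.toFinset, fun μ => Module.finrank ℂ (f.eigenspace μ), fun μ hμ => ?_, fun k => ?_⟩
  · obtain ⟨v, hv, hv0⟩ := Submodule.exists_mem_ne_zero_of_ne_bot (hfin.mem_toFinset.1 hμ)
    have := hpow N μ v hv
    rw [hf, Module.End.one_apply] at this
    by_contra hne
    have h2 : (μ ^ N - 1) • v = 0 := by rw [sub_smul, one_smul, ← this, sub_self]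
    exact (smul_ne_zero (sub_ne_zero.2 hne) hv0) h2
  · have hmaps (μ : ℂ) : Set.MapsTo (f ^ k) (f.eigenspace μ) (f.eigenspace μ) := fun v hv => by
      rw [hpow k μ v hv]
      exact Submodule.smul_mem _ _ hv
    rw [LinearMap.trace_eq_sum_trace_restrict' hint hfin hmaps]
    refine Finset.sum_congr rfl fun μ _ => ?_
    have : (f ^ k).restrict (hmaps μ) = μ ^ k • (1 : Module.End ℂ (f.eigenspace μ)) := by
      ext v
      exact hpow k μ v v.2
    rw [this, map_smul, LinearMap.trace_one, smul_eq_mul, mul_comm]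

/-! ### Characters of representations over `ℂ` -/

namespace Representation

/-! ### Irreducibility via invariant subspaces -/

section Irreducible

variable {k G V : Type*} [Monoid G] [Field k] [AddCommGroup V] [Module k V]

theorem isIrreducible_iff_forall_submodule (ρ : Representation k G V) :
    ρ.IsIrreducible ↔ Nontrivial V ∧
      ∀ W : Submodule k V, (∀ g, ∀ v ∈ W, ρ g v ∈ W) → W = ⊥ ∨ W = ⊤ := by
  constructor
  · intro h
    refine ⟨?_, fun W hW => ?_⟩
    · by_contra hV
      rw [not_nontrivial_iff_subsingleton] at hV
      exact bot_ne_top (α := Subrepresentation ρ)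
        (Subrepresentation.toSubmodule_injective (Subsingleton.elim _ _))
    · rcases h.eq_bot_or_eq_top ⟨W, fun g v hv => hW g v hv⟩ with h1 | h1
      · exact Or.inl (congrArg Subrepresentation.toSubmodule h1)
      · exact Or.inr (congrArg Subrepresentation.toSubmodule h1)
  · rintro ⟨hV, h⟩
    refine { exists_pair_ne := ⟨⊥, ⊤, fun h1 => ?_⟩, eq_bot_or_eq_top := fun W => ?_ }
    · exact bot_ne_top (α := Submodule k V) (congrArg Subrepresentation.toSubmodule h1)
    · rcases h W.toSubmodule (fun g v hv => W.apply_mem_toSubmodule g hv) with h1 | h1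
      · exact Or.inl (Subrepresentation.toSubmodule_injective h1)
      · exact Or.inr (Subrepresentation.toSubmodule_injective h1)

/-- Irreducibility is transported along semilinear equivariant bijections. -/
theorem IsIrreducible.of_semilinear {V' : Type*} [AddCommGroup V'] [Module k V']
    {ρ : Representation k G V} {ρ' : Representation k G V'} (h : ρ.IsIrreducible) (σ : k ≃+* k)
    (e : V ≃+ V') (he : ∀ (c : k) (v : V), e (c • v) = σ c • e v)
    (heq : ∀ g v, e (ρ g v) = ρ' g (e v)) : ρ'.IsIrreducible := by
  rw [isIrreducible_iff_forall_submodule] at h ⊢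
  obtain ⟨hV, h⟩ := h
  refine ⟨e.symm.toEquiv.nontrivial, fun W hW => ?_⟩
  let W' : Submodule k V :=
    { carrier := {v | e v ∈ W}
      add_mem' := fun {a b} ha hb => by
        simpa using W.add_mem ha hb
      zero_mem' := by simp
      smul_mem' := fun c v hv => by
        simpa [he] using W.smul_mem (σ c) hv }
  have hmem (v : V) : v ∈ W' ↔ e v ∈ W := Iff.rfl
  rcases h W' (fun g v hv => by rw [hmem, heq]; exact hW g _ hv) with h1 | h1
  · left
    rw [Submodule.eq_bot_iff]
    intro w hw
    have : e.symm w ∈ W' := by simpa [hmem] using hw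
    rw [h1, Submodule.mem_bot] at this
    simpa using this
  · right
    rw [Submodule.eq_top_iff']
    intro w
    have : e.symm w ∈ W' := h1 ▸ Submodule.mem_top
    simpa [hmem] using this

end Irreducible

/-! ### Characters under change of space and Galois twist -/

section Transport

variable {G : Type*} [Monoid G]

theorem exists_character_eq_of_isIrreducible {V : Type*} [AddCommGroup V] [Module ℂ V]
    [FiniteDimensional ℂ V] (ρ : Representation ℂ G V) (h : ρ.IsIrreducible) :
    ∃ (n : ℕ) (ρ' : Representation ℂ G (Fin n → ℂ)), ρ'.IsIrreducible ∧
      ρ.character = ρ'.character := by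
  let e : V ≃ₗ[ℂ] (Fin (Module.finrank ℂ V) → ℂ) := (Module.finBasis ℂ V).equivFun
  let ρ' : Representation ℂ G (Fin (Module.finrank ℂ V) → ℂ) :=
    (e.conjAlgEquiv ℂ : Module.End ℂ V →* Module.End ℂ _).comp ρ
  have hρ' (g : G) : ρ' g = e.conj (ρ g) := rfl
  refine ⟨_, ρ', h.of_semilinear (RingEquiv.refl ℂ) e.toAddEquiv (by simp) (fun g v => ?_), ?_⟩
  · simp [hρ', LinearEquiv.conj_apply]
  · ext g
    rw [character, character, hρ', LinearMap.trace_conj']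

/-- The representation obtained by applying a field automorphism to all matrix entries. -/
noncomputable def galoisTwist {n : ℕ} (ρ : Representation ℂ G (Fin n → ℂ)) (σ : ℂ ≃+* ℂ) :
    Representation ℂ G (Fin n → ℂ) where
  toFun g := Matrix.toLin' ((LinearMap.toMatrix' (ρ g)).map σ)
  map_one' := by
    rw [map_one, LinearMap.toMatrix'_one, Matrix.map_one _ (map_zero σ) (map_one σ),
      Matrix.toLin'_one]
    rfl
  map_mul' g h := by
    rw [map_mul, LinearMap.toMatrix'_mul, Matrix.map_mul, Matrix.toLin'_mul]
    rfl

theorem galoisTwist_apply {n : ℕ} (ρ : Representation ℂ G (Fin n → ℂ)) (σ : ℂ ≃+* ℂ) (g : G) :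
    ρ.galoisTwist σ g = Matrix.toLin' ((LinearMap.toMatrix' (ρ g)).map σ) := rfl

theorem galoisTwist_character {n : ℕ} (ρ : Representation ℂ G (Fin n → ℂ)) (σ : ℂ ≃+* ℂ) (g : G) :
    (ρ.galoisTwist σ).character g = σ (ρ.character g) := by
  rw [character, character, galoisTwist_apply, Matrix.trace_toLin'_eq]
  conv_rhs => rw [← Matrix.toLin'_toMatrix' (ρ g), Matrix.trace_toLin'_eq]
  simp [Matrix.trace]

/-- Applying `σ` to coordinates is a `σ`-semilinear bijection intertwining `ρ` with its twist. -/
theorem IsIrreducible.galoisTwist {n : ℕ} {ρ : Representation ℂ G (Fin n → ℂ)}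
    (h : ρ.IsIrreducible) (σ : ℂ ≃+* ℂ) : (ρ.galoisTwist σ).IsIrreducible := by
  refine h.of_semilinear σ (AddEquiv.piCongrRight fun _ => σ.toAddEquiv) (fun c v => ?_)
    (fun g v => ?_)
  · ext i; simp
  · have hv : ρ g v = (LinearMap.toMatrix' (ρ g)).mulVec v := by
      rw [← Matrix.toLin'_apply, Matrix.toLin'_toMatrix']
    rw [galoisTwist_apply, Matrix.toLin'_apply, hv]
    ext i
    simp [Matrix.mulVec, dotProduct, -LinearMap.toMatrix'_mulVec]

end Transport

/-! ### Character values as sums of roots of unity -/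

section Power

variable {G : Type*} [Group G] [Finite G] {V : Type*} [AddCommGroup V] [Module ℂ V]
  [FiniteDimensional ℂ V] (ρ : Representation ℂ G V)

theorem exists_character_pow_eq_sum (g : G) :
    ∃ (s : Finset ℂ) (d : ℂ → ℕ), (∀ μ ∈ s, μ ^ Nat.card G = 1) ∧
      ∀ k : ℕ, ρ.character (g ^ k) = ∑ μ ∈ s, d μ * μ ^ k := by
  obtain ⟨s, d, h1, h2⟩ := LinearMap.exists_trace_pow_eq_sum (f := ρ g) (N := Nat.card G)
    Nat.card_pos.ne' (by rw [← map_pow, pow_card_eq_one', map_one])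
  exact ⟨s, d, h1, fun k => by rw [character, map_pow, h2]⟩

/-- The eigenvalues of `ρ g` are `|G|`-th roots of unity and their multiplicities are integers,
which `σ` fixes. -/
theorem map_character_eq_character_pow (σ : ℂ →+* ℂ) {k : ℕ}
    (hk : ∀ μ : ℂ, μ ^ Nat.card G = 1 → σ μ = μ ^ k) (g : G) :
    σ (ρ.character g) = ρ.character (g ^ k) := by
  obtain ⟨s, d, h1, h2⟩ := ρ.exists_character_pow_eq_sum g
  have h3 := h2 1
  rw [pow_one] at h3
  rw [h3, h2 k, map_sum]
  refine Finset.sum_congr rfl fun μ hμ => ?_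
  simp [hk μ (h1 μ hμ)]

theorem isAlgebraic_character (g : G) : IsAlgebraic ℚ (ρ.character g) := by
  obtain ⟨s, d, h1, h2⟩ := ρ.exists_character_pow_eq_sum g
  have h3 := h2 1
  rw [pow_one] at h3
  rw [h3, isAlgebraic_iff_isIntegral]
  refine IsIntegral.sum _ fun μ hμ => ?_
  rw [pow_one]
  refine IsIntegral.mul ?_ (IsIntegral.of_pow (Nat.card_pos (α := G)) ?_)
  · simpa using isIntegral_algebraMap (R := ℚ) (A := ℂ) (x := (d μ : ℚ))
  · rw [h1 μ hμ]
    exact isIntegral_one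

theorem character_inv (g : G) : ρ.character g⁻¹ = starRingEnd ℂ (ρ.character g) := by
  have hN : 0 < Nat.card G := Nat.card_pos
  have hinv : g⁻¹ = g ^ (Nat.card G - 1) := by
    rw [inv_eq_iff_mul_eq_one, ← pow_succ', Nat.sub_add_cancel hN, pow_card_eq_one']
  rw [hinv]
  refine (ρ.map_character_eq_character_pow (starRingEnd ℂ) (fun μ hμ => ?_) g).symm
  have h1 : ‖μ‖ = 1 := Complex.norm_eq_one_of_pow_eq_one hμ hN.ne'
  rw [← Complex.inv_eq_conj h1, inv_eq_iff_eq_inv, eq_comm, inv_eq_of_mul_eq_one_right]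
  rw [← pow_succ, Nat.sub_add_cancel hN, hμ]

end Power

/-! ### Completeness of the irreducible characters -/

section Complete

variable {G : Type*} [Group G] [Fintype G]

/-- A class function orthogonal to all irreducible characters annihilates all representations. -/
theorem sum_smul_eq_zero_of_forall_irreducible {f : G → ℂ} (hf : ∀ g h, f (h * g * h⁻¹) = f g)
    (H : ∀ (n : ℕ) (ρ : Representation ℂ G (Fin n → ℂ)), ρ.IsIrreducible →
      ∑ g, f g * ρ.character g = 0) (d : ℕ) {V : Type*} [AddCommGroup V] [Module ℂ V]
    [FiniteDimensional ℂ V] (hd : Module.finrank ℂ V = d) (ρ : Representation ℂ G V) :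
    ∑ g, f g • ρ g = 0 := by
  induction d using Nat.strong_induction_on generalizing V with
  | _ d ih =>
  by_cases hirr : ρ.IsIrreducible
  -- As `f` is a class function, the sum commutes with `ρ`; by Schur it is a scalar, and its trace
  -- is zero by `H`.
  · let T : IntertwiningMap ρ ρ := LinearMap.intertwiningMap_of_isIntertwiningMap _ _
      (∑ g, f g • ρ g) fun h v => by
        simp only [LinearMap.sum_apply, LinearMap.smul_apply, map_sum, map_smul]
        refine Fintype.sum_equiv (MulAut.conj h).symm.toEquiv _ _ fun g => ?_
        have h1 : f (h⁻¹ * g * h) = f g := by simpa using hf g h⁻¹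
        rw [mul_assoc] at h1
        simp [h1, ← Module.End.mul_apply, ← map_mul, mul_assoc]
    obtain ⟨c, hc⟩ :=
      (IsIrreducible.algebraMap_intertwiningMap_bijective_of_isAlgClosed (ρ := ρ)).2 T
    have hT : ∑ g, f g • ρ g = c • (1 : Module.End ℂ V) := by
      have := congrArg IntertwiningMap.toLinearMap hc
      exact this.symm
    have htr := congrArg (LinearMap.trace ℂ V) hT
    obtain ⟨n, ρ', h1, h2⟩ := ρ.exists_character_eq_of_isIrreducible hirr
    have := H n ρ' h1
    rw [← h2] at this
    have h0 : LinearMap.trace ℂ V (∑ g, f g • ρ g) = 0 := by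
      rw [← this]
      simp [character]
    rw [h0, map_smul, LinearMap.trace_one, smul_eq_mul, eq_comm, mul_eq_zero] at htr
    have : Nontrivial V := ((isIrreducible_iff_forall_submodule ρ).1 hirr).1
    have hne : (Module.finrank ℂ V : ℂ) ≠ 0 := by exact_mod_cast Module.finrank_pos.ne'
    rw [hT, htr.resolve_right hne, zero_smul]
  · rcases subsingleton_or_nontrivial V with hV | hV
    · ext v; exact Subsingleton.elim _ _
    rw [isIrreducible_iff_forall_submodule] at hirr
    push Not at hirr
    obtain ⟨W, hW, hbot, htop⟩ := hirr hV
    have : NeZero (Nat.card G : ℂ) := ⟨by exact_mod_cast Nat.card_pos.ne'⟩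
    -- Maschke: `V` splits into two proper invariant subspaces, each covered by induction.
    obtain ⟨W', hW'⟩ := exists_isCompl (⟨W, fun g v hv => hW g v hv⟩ : Subrepresentation ρ)
    have key (U : Subrepresentation ρ) (hU : U.toSubmodule ≠ ⊤) :
        ∀ v ∈ U.toSubmodule, (∑ g, f g • ρ g) v = 0 := fun v hv => by
      have := ih _ (hd ▸ Submodule.finrank_lt hU) (V := U.toSubmodule) rfl
        U.toRepresentation
      have := congrArg (fun T => ((T ⟨v, hv⟩ : U.toSubmodule) : V)) this
      simpa [Subrepresentation.toRepresentation] using this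
    have hsup : W ⊔ W'.toSubmodule = ⊤ := by
      have := congrArg Subrepresentation.toSubmodule hW'.sup_eq_top
      exact this
    have hinf : W ⊓ W'.toSubmodule = ⊥ := by
      have := congrArg Subrepresentation.toSubmodule hW'.inf_eq_bot
      exact this
    have hW'top : W'.toSubmodule ≠ ⊤ := fun h => hbot (by rwa [h, inf_top_eq] at hinf)
    ext v
    obtain ⟨a, ha, b, hb, rfl⟩ := Submodule.mem_sup.1 (hsup ▸ Submodule.mem_top : v ∈ _)
    rw [map_add, key ⟨W, fun g v hv => hW g v hv⟩ htop a ha, key W' hW'top b hb]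
    simp

theorem eq_zero_of_forall_irreducible {f : G → ℂ} (hf : ∀ g h, f (h * g * h⁻¹) = f g)
    (H : ∀ (n : ℕ) (ρ : Representation ℂ G (Fin n → ℂ)), ρ.IsIrreducible →
      ∑ g, f g * ρ.character g = 0) : f = 0 := by
  have h := sum_smul_eq_zero_of_forall_irreducible hf H _ rfl
    (Representation.leftRegular ℂ G)
  ext x
  -- In the regular representation, `∑ f g • g` applied to the identity has coefficient `f x` at
  -- `x`.
  have := congrArg (fun T => (T (MonoidAlgebra.single 1 1)).coeff x) h
  have h1 : ∑ c, (Finsupp.single c (f c)) x = 0 := by simpa using this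
  rwa [Finset.sum_eq_single x (fun c _ hc => Finsupp.single_eq_of_ne hc.symm)
    (fun hx => absurd (Finset.mem_univ x) hx), Finsupp.single_eq_same] at h1

end Complete

end Representation

/-! ### Commuting actions with few moved points -/

namespace MulAction

variable {A C : Type*} [Group A] [MulAction A C]

section Commuting

variable (hcomm : ∀ (a b : A) (c : C), a • b • c = b • a • c)

include hcomm

/-- Normality makes the orbit of `c` a copy of the group `A ⧸ stabilizer A c`, where generators can
be sought. -/
theorem stabilizer_normal_of_commuting (c : C) : (stabilizer A c).Normal where
  conj_mem n hn g := by
    rw [mem_stabilizer_iff] at hn ⊢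
    rw [mul_smul, mul_smul, hcomm n, hn, smul_inv_smul]

/-- If an orbit has prime length, the powers of any element moving a point of it act
transitively. -/
theorem exists_zpow_smul_of_prime {c : C} (hp : (orbit A c).ncard.Prime) {a : A} (ha : a • c ≠ c)
    {d : C} (hd : d ∈ orbit A c) (b : A) : ∃ n : ℤ, b • d = a ^ n • d := by
  have := stabilizer_normal_of_commuting hcomm c
  have : Fact (orbit A c).ncard.Prime := ⟨hp⟩
  have hcard : Nat.card (A ⧸ stabilizer A c) = (orbit A c).ncard :=
    (Nat.card_congr (orbitEquivQuotientStabilizer A c)).symm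
  have ha' : (a : A ⧸ stabilizer A c) ≠ 1 := by
    rwa [Ne, QuotientGroup.eq_one_iff, mem_stabilizer_iff]
  obtain ⟨n, hn⟩ := Subgroup.mem_zpowers_iff.1
    (mem_zpowers_of_prime_card hcard ha' (g' := (b : A ⧸ stabilizer A c)))
  rw [← QuotientGroup.mk_zpow, QuotientGroup.eq, mem_stabilizer_iff, mul_smul,
    inv_smul_eq_iff] at hn
  obtain ⟨e, rfl⟩ := hd
  exact ⟨n, by simp only; rw [hcomm b, hcomm _ e, hn]⟩

theorem exists_zpow_smul_of_card_four {c : C} (h4 : (orbit A c).ncard = 4) {a : A}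
    (ha : a • a • c ≠ c) {d : C} (hd : d ∈ orbit A c) (b : A) : ∃ n : ℤ, b • d = a ^ n • d := by
  have := stabilizer_normal_of_commuting hcomm c
  have hcard : Nat.card (A ⧸ stabilizer A c) = 4 :=
    (Nat.card_congr (orbitEquivQuotientStabilizer A c)).symm.trans h4
  have ha' : (a : A ⧸ stabilizer A c) ^ 2 ≠ 1 := by
    rwa [Ne, ← QuotientGroup.mk_pow, QuotientGroup.eq_one_iff, mem_stabilizer_iff, sq, mul_smul]
  have hord : orderOf (a : A ⧸ stabilizer A c) = 4 := by
    have h1 : orderOf (a : A ⧸ stabilizer A c) ∣ 4 := hcard ▸ orderOf_dvd_natCard _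
    have h2 : ¬ orderOf (a : A ⧸ stabilizer A c) ∣ 2 := fun h => ha' (orderOf_dvd_iff_pow_eq_one.1 h)
    have h3 := Nat.le_of_dvd (by norm_num) h1
    interval_cases orderOf (a : A ⧸ stabilizer A c) <;> simp_all
  have : Finite (A ⧸ stabilizer A c) := Nat.finite_of_card_ne_zero (by rw [hcard]; norm_num)
  have htop : Subgroup.zpowers (a : A ⧸ stabilizer A c) = ⊤ :=
    Subgroup.eq_top_of_card_eq _ (by rw [Nat.card_zpowers, hord, hcard])
  obtain ⟨n, hn⟩ := Subgroup.mem_zpowers_iff.1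
    (htop ▸ Subgroup.mem_top (b : A ⧸ stabilizer A c))
  rw [← QuotientGroup.mk_zpow, QuotientGroup.eq, mem_stabilizer_iff, mul_smul,
    inv_smul_eq_iff] at hn
  obtain ⟨e, rfl⟩ := hd
  exact ⟨n, by simp only; rw [hcomm b, hcomm _ e, hn]⟩

theorem smul_ne_of_mem_orbit {c d : C} (hd : d ∈ orbit A c) {a : A} (ha : a • c ≠ c) :
    a • d ≠ d := by
  obtain ⟨e, rfl⟩ := hd
  intro h
  simp only at h
  rw [hcomm] at h
  exact ha (smul_left_cancel e h)

end Commuting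

/-- The moved points form a single orbit, on which `A` acts as a Klein four-group. -/
structure IsKleinOrbit (a b : A) (c : C) : Prop where
  left : a • a • c = c
  right : b • b • c = c
  ne_left : a • c ≠ c
  ne_right : b • c ≠ c
  ne : a • c ≠ b • c
  eq_of_notMem : ∀ d, d ∉ fixedPoints A C → d = c ∨ d = a • c ∨ d = b • c ∨ d = a • b • c

theorem orbit_subset_compl_fixedPoints {c : C} (hc : c ∉ fixedPoints A C) :
    orbit A c ⊆ (fixedPoints A C)ᶜ := by
  rintro _ ⟨e, rfl⟩ h
  refine hc fun b => ?_
  have h1 := h (e⁻¹)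
  have h2 := h (b * e⁻¹)
  simp only [inv_smul_smul] at h1
  simp only [mul_smul, inv_smul_smul] at h2
  exact h2.trans h1.symm

theorem disjoint_orbit_of_notMem {c d : C} (h : d ∉ orbit A c) :
    Disjoint (orbit A c) (orbit A d) := by
  refine Set.disjoint_left.2 fun x hc hd => h ?_
  rw [← orbit_eq_iff.2 hc, orbit_eq_iff.2 hd]
  exact mem_orbit_self d

theorem two_le_ncard_orbit [Finite C] {c : C} (hc : c ∉ fixedPoints A C) :
    2 ≤ (orbit A c).ncard := by
  simp only [mem_fixedPoints, not_forall] at hc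
  obtain ⟨a, ha⟩ := hc
  exact (Set.one_lt_ncard (Set.toFinite _)).2 ⟨a • c, mem_orbit _ _, c, mem_orbit_self _, ha⟩

/-- A commuting action moving at most five points either has the same orbits as one of its
elements, or it is a Klein four-group acting regularly on the moved points. -/
theorem exists_zpow_smul_or_isKleinOrbit [Finite C]
    (hcomm : ∀ (a b : A) (c : C), a • b • c = b • a • c)
    (h5 : (fixedPoints A C)ᶜ.ncard ≤ 5) :
    (∃ a : A, ∀ (b : A) (c : C), ∃ n : ℤ, b • c = a ^ n • c) ∨
      ∃ (a b : A) (c : C), IsKleinOrbit a b c := by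
  rcases (fixedPoints A C)ᶜ.eq_empty_or_nonempty with h0 | ⟨c₁, hc₁⟩
  · refine Or.inl ⟨1, fun b c => ⟨0, ?_⟩⟩
    have hc : c ∈ fixedPoints A C := by
      by_contra hc
      exact (h0 ▸ hc : c ∈ (∅ : Set C))
    simpa using hc b
  have hs₁ := two_le_ncard_orbit hc₁
  have hsub₁ := orbit_subset_compl_fixedPoints hc₁
  have hle₁ := Set.ncard_le_ncard hsub₁ (Set.toFinite _)
  have hmov (c : C) (hc : c ∉ fixedPoints A C) : ∃ a : A, a • c ≠ c := by
    simpa [mem_fixedPoints] using hc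
  by_cases hone : ∀ d, d ∉ fixedPoints A C → d ∈ orbit A c₁
  · have hfin (a : A) (h : ∀ d ∈ orbit A c₁, ∀ b : A, ∃ n : ℤ, b • d = a ^ n • d) (b : A) (c : C) :
        ∃ n : ℤ, b • c = a ^ n • c := by
      by_cases hc : c ∈ fixedPoints A C
      · exact ⟨0, by simpa using hc b⟩
      · exact h c (hone c hc) b
    -- Among the lengths 2 to 5 only 4 is not prime.
    by_cases hp : (orbit A c₁).ncard.Prime
    · obtain ⟨a, ha⟩ := hmov c₁ hc₁
      exact Or.inl ⟨a, hfin a fun d hd b => exists_zpow_smul_of_prime hcomm hp ha hd b⟩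
    have h4 : (orbit A c₁).ncard = 4 := by
      have h5' := hle₁.trans h5
      interval_cases (orbit A c₁).ncard <;> first | rfl | (exact absurd (by norm_num) hp)
    by_cases hsq : ∃ a : A, a • a • c₁ ≠ c₁
    · obtain ⟨a, ha⟩ := hsq
      exact Or.inl ⟨a, hfin a fun d hd b => exists_zpow_smul_of_card_four hcomm h4 ha hd b⟩
    push Not at hsq
    obtain ⟨a, ha⟩ := hmov c₁ hc₁
    obtain ⟨_, ⟨b, rfl⟩, hb⟩ : ∃ d ∈ orbit A c₁, d ∉ ({c₁, a • c₁} : Set C) := by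
      by_contra! hcon
      have := Set.ncard_le_ncard (fun d hd => hcon d hd : orbit A c₁ ⊆ {c₁, a • c₁})
      have := this.trans (Set.ncard_insert_le _ _)
      simp at this
      omega
    simp only [Set.mem_insert_iff, Set.mem_singleton_iff, not_or] at hb
    have hne : a • b • c₁ ≠ c₁ := fun h => hb.2 (by
      have := congrArg (a • ·) h
      rwa [hcomm a b, hcomm a b, hsq] at this)
    have hset : ({c₁, a • c₁, b • c₁, a • b • c₁} : Set C) = orbit A c₁ := by
      refine Set.eq_of_subset_of_ncard_le ?_ ?_
      · rintro d (rfl | rfl | rfl | rfl)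
        · exact mem_orbit_self _
        · exact mem_orbit _ _
        · exact mem_orbit _ _
        · rw [← mul_smul]; exact mem_orbit _ _
      · rw [h4, Set.ncard_insert_of_notMem, Set.ncard_insert_of_notMem, Set.ncard_pair]
        · exact fun h => smul_ne_of_mem_orbit hcomm (mem_orbit c₁ b) ha h.symm
        · rintro (h | h)
          · exact hb.2 h.symm
          · exact hb.1 (smul_left_cancel a h).symm
        · rintro (h | h | h)
          · exact ha h.symm
          · exact hb.1 h.symm
          · exact hne h.symm
    refine Or.inr ⟨a, b, c₁, hsq a, hsq b, ha, hb.1, fun h => hb.2 h.symm, fun d hd => ?_⟩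
    have := hone d hd
    rw [← hset] at this
    simpa using this
  · push Not at hone
    obtain ⟨c₂, hc₂, hc₂'⟩ := hone
    have hs₂ := two_le_ncard_orbit hc₂
    have hsub₂ := orbit_subset_compl_fixedPoints hc₂
    have hdisj₁₂ : Disjoint (orbit A c₁) (orbit A c₂) :=
      disjoint_orbit_of_notMem hc₂'
    have hun : (orbit A c₁ ∪ orbit A c₂).ncard = (orbit A c₁).ncard + (orbit A c₂).ncard :=
      Set.ncard_union_eq hdisj₁₂
    have hle := Set.ncard_le_ncard (Set.union_subset hsub₁ hsub₂) (Set.toFinite _)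
    -- Every orbit of moved points has length at least two, so three orbits would need six points.
    have hcover (d : C) (hd : d ∉ fixedPoints A C) : d ∈ orbit A c₁ ∨ d ∈ orbit A c₂ := by
      by_contra! hcon
      have hs₃ := two_le_ncard_orbit hd
      have hdisj : Disjoint (orbit A c₁ ∪ orbit A c₂) (orbit A d) :=
        Set.disjoint_union_left.2
          ⟨disjoint_orbit_of_notMem hcon.1, disjoint_orbit_of_notMem hcon.2⟩
      have := Set.ncard_union_eq hdisj
      have := Set.ncard_le_ncard (Set.union_subset (Set.union_subset hsub₁ hsub₂)
        (orbit_subset_compl_fixedPoints hd)) (Set.toFinite _)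
      omega
    have hp₁ : (orbit A c₁).ncard.Prime := by
      have : (orbit A c₁).ncard ≤ 3 := by omega
      interval_cases (orbit A c₁).ncard <;> norm_num
    have hp₂ : (orbit A c₂).ncard.Prime := by
      have : (orbit A c₂).ncard ≤ 3 := by omega
      interval_cases (orbit A c₂).ncard <;> norm_num
    -- If neither of two elements moves both points, their product does.
    obtain ⟨a, ha₁, ha₂⟩ : ∃ a : A, a • c₁ ≠ c₁ ∧ a • c₂ ≠ c₂ := by
      obtain ⟨a, ha⟩ := hmov c₁ hc₁
      obtain ⟨b, hb⟩ := hmov c₂ hc₂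
      by_cases ha' : a • c₂ = c₂
      · by_cases hb' : b • c₁ = c₁
        · refine ⟨a * b, ?_, ?_⟩
          · rwa [mul_smul, hb']
          · rwa [mul_smul, hcomm, ha']
        · exact ⟨b, hb', hb⟩
      · exact ⟨a, ha, ha'⟩
    refine Or.inl ⟨a, fun b c => ?_⟩
    by_cases hc : c ∈ fixedPoints A C
    · exact ⟨0, by simpa using hc b⟩
    · rcases hcover c hc with h | h
      · exact exists_zpow_smul_of_prime hcomm hp₁ ha₁ h b
      · exact exists_zpow_smul_of_prime hcomm hp₂ ha₂ h b

end MulAction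

open MulAction

/-! ### Two sets permuted by automorphisms of `ℂ` -/

namespace LinearMap

/-- The trace of an operator permuting a basis is the number of fixed basis vectors. -/
theorem trace_eq_ncard_fixedPoints {ι M : Type*} [Finite ι] [AddCommGroup M] [Module ℂ M]
    (b : Module.Basis ι ℂ M) (T : M →ₗ[ℂ] M) (π : ι → ι) (h : ∀ i, T (b i) = b (π i)) :
    LinearMap.trace ℂ M T = {i | π i = i}.ncard := by
  classical
  have := Fintype.ofFinite ι
  rw [LinearMap.trace_eq_matrix_trace ℂ b, Matrix.trace]
  simp [LinearMap.toMatrix_apply, h, Finsupp.single_apply, Set.ncard_eq_toFinset_card']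

end LinearMap

section Table

variable {A C I : Type*} [Group A] [MulAction A C] [MulAction A I] {X : I → C → ℂ}

theorem fixedPoints_eq_fixedBy_of_forall_zpow {a : A}
    (ha : ∀ (b : A) (c : C), ∃ n : ℤ, b • c = a ^ n • c) : fixedPoints A C = fixedBy C a := by
  ext c
  refine ⟨fun h => h a, fun h b => ?_⟩
  obtain ⟨n, hn⟩ := ha b c
  rw [hn]
  exact zpow_smul_eq_iff_minimalPeriod_dvd.2 (by simp [Function.minimalPeriod_eq_one_iff_isFixedPt.2 h])

/-- Brauer's permutation lemma. -/
theorem ncard_fixedBy_eq_of_basis [Finite C] [Finite I] (b : Module.Basis I ℂ (C → ℂ))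
    (hX : ∀ (a : A) i c, b (a • i) c = b i (a • c)) (a : A) :
    (fixedBy C a).ncard = (fixedBy I a).ncard := by
  classical
  have := Fintype.ofFinite C
  -- `T` permutes both the basis `b` and the indicator functions; its trace counts fixed points in
  -- either basis.
  let T : (C → ℂ) →ₗ[ℂ] (C → ℂ) := LinearMap.funLeft ℂ ℂ (a • ·)
  have h1 := LinearMap.trace_eq_ncard_fixedPoints b T (a • ·) fun i => by
    ext c
    simp [T, LinearMap.funLeft_apply, hX]
  have h2 := LinearMap.trace_eq_ncard_fixedPoints (Pi.basisFun ℂ C) T (a⁻¹ • ·) fun c => by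
    ext d
    simp [T, LinearMap.funLeft_apply, Pi.single_apply, eq_inv_smul_iff]
  have h3 : {c : C | a⁻¹ • c = c} = fixedBy C a := by
    ext c
    rw [Set.mem_ofPred_eq, inv_smul_eq_iff, mem_fixedBy, eq_comm]
  rw [h2, h3] at h1
  exact_mod_cast h1

/-- The exponent `n` depends on `c`, so the argument is made one column at a time: a row fixed by
`a` is fixed by every power of `a`. -/
theorem fixedPoints_eq_fixedBy_table (hX : ∀ (a : A) i c, X (a • i) c = X i (a • c))
    (hinj : Function.Injective X) {a : A}
    (ha : ∀ (b : A) (c : C), ∃ n : ℤ, b • c = a ^ n • c) : fixedPoints A I = fixedBy I a := by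
  ext i
  refine ⟨fun h => h a, fun h b => hinj (funext fun c => ?_)⟩
  obtain ⟨n, hn⟩ := ha b c
  have hi : a ^ n • i = i :=
    zpow_smul_eq_iff_minimalPeriod_dvd.2 (by simp [Function.minimalPeriod_eq_one_iff_isFixedPt.2 h])
  rw [hX, hn, ← hX, hi]

end Table

/-! ### Symmetry among the three involutions -/

namespace MulAction.IsKleinOrbit

variable {A C : Type*} [Group A] [MulAction A C] {a b : A} {c : C}

theorem swap (hcomm : ∀ (a b : A) (c : C), a • b • c = b • a • c) (h : IsKleinOrbit a b c) :
    IsKleinOrbit b a c where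
  left := h.right
  right := h.left
  ne_left := h.ne_right
  ne_right := h.ne_left
  ne := h.ne.symm
  eq_of_notMem d hd := by
    have := h.eq_of_notMem d hd
    rw [hcomm b a]
    tauto

theorem mul_left (hcomm : ∀ (a b : A) (c : C), a • b • c = b • a • c) (h : IsKleinOrbit a b c) :
    IsKleinOrbit (a * b) b c where
  left := by rw [mul_smul, mul_smul, hcomm b a, h.right, h.left]
  right := h.right
  ne_left h' := h.ne (by
    rw [mul_smul] at h'
    have := congrArg (a • ·) h'
    rw [hcomm a b, hcomm a b, h.left] at this
    exact this.symm)
  ne_right := h.ne_right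
  ne h' := h.ne_left (smul_left_cancel b (by rw [mul_smul, hcomm] at h'; exact h'))
  eq_of_notMem d hd := by
    have := h.eq_of_notMem d hd
    rw [mul_smul, mul_smul, h.right]
    tauto

theorem notMem (h : IsKleinOrbit a b c) : c ∉ fixedPoints A C := fun h' => h.ne_left (h' a)

theorem fixedBy_eq (hcomm : ∀ (a b : A) (c : C), a • b • c = b • a • c)
    (h : IsKleinOrbit a b c) : fixedBy C a = fixedPoints A C := by
  refine Set.Subset.antisymm (fun d hd => ?_) fun d hd => hd a
  by_contra hd'
  refine smul_ne_of_mem_orbit hcomm (c := c) ?_ h.ne_left hd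
  rcases h.eq_of_notMem d hd' with rfl | rfl | rfl | rfl
  · exact mem_orbit_self _
  · exact mem_orbit _ _
  · exact mem_orbit _ _
  · rw [← mul_smul]; exact mem_orbit _ _

/-- An `a`-fixed function on `C` with equal values at `c` and `b • c` is constant on orbits. -/
theorem apply_smul_eq (h : IsKleinOrbit a b c) {f : C → ℂ} (hf : ∀ d, f (a • d) = f d) (hb : f (b • c) = f c)
    (e : A) (d : C) : f (e • d) = f d := by
  have hall (d : C) (hd : d ∉ fixedPoints A C) : f d = f c := by
    rcases h.eq_of_notMem d hd with rfl | rfl | rfl | rfl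
    · rfl
    · exact hf _
    · exact hb
    · rw [hf, hb]
  by_cases hd : d ∈ fixedPoints A C
  · rw [hd e]
  · rw [hall d hd, hall _ (orbit_subset_compl_fixedPoints hd (mem_orbit d e))]

end MulAction.IsKleinOrbit

/-! ### The Klein four-group case -/

section Klein

variable {C I γ : Type*} [MulAction (ℂ ≃+* ℂ) C] [MulAction (ℂ ≃+* ℂ) I] {X : I → C → ℂ}

variable (hcomm : ∀ (a b : ℂ ≃+* ℂ) (c : C), a • b • c = b • a • c)
  (hX : ∀ (a : ℂ ≃+* ℂ) i c, X (a • i) c = X i (a • c))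
  (hval : ∀ (a : ℂ ≃+* ℂ) i c, a (X i c) = X i (a • c))
  (hinj : Function.Injective X)
  [Fintype γ] (p : γ → C) {N : ℂ} (ι : ℂ ≃+* ℂ)
  (horth : ∀ i, ∑ g, X i (p g) * X i (ι • p g) = N)
  (horth' : ∀ i j, i ≠ j → ∑ g, X i (p g) * X j (ι • p g) = 0)

include hcomm hX hval hinj horth horth'

open scoped Classical in
theorem exists_eigenvalue_of_isKleinOrbit {a b : ℂ ≃+* ℂ} {c : C} (h : IsKleinOrbit a b c)
    {i : I} (hi : a • i = i) (hi' : i ∉ fixedPoints (ℂ ≃+* ℂ) I) :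
    ∃ z : ℂ, z ≠ 0 ∧ a z = z ∧ b z = -z ∧
      (z ^ 2 * (Finset.univ.filter fun g => p g ∉ fixedPoints (ℂ ≃+* ℂ) C).card = 2 * N ∨
        z ^ 2 * (Finset.univ.filter fun g => p g ∉ fixedPoints (ℂ ≃+* ℂ) C).card = -(2 * N)) := by
  have hai (d : C) : X i (a • d) = X i d := by rw [← hX, hi]
  have hz0 : X i (b • c) - X i c ≠ 0 := fun h0 => hi' fun e => hinj <| funext fun d => by
    rw [hX]
    exact h.apply_smul_eq hai (sub_eq_zero.1 h0) e d
  have hne : b • i ≠ i := fun h' => hz0 (by rw [← hX, h', sub_self])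
  -- `D` is the difference of two distinct conjugate characters, supported on the moved classes.
  let D : C → ℂ := fun d => X (b • i) d - X i d
  have hDfix (d : C) (hd : d ∈ fixedPoints (ℂ ≃+* ℂ) C) : D d = 0 := by
    simp only [D]
    rw [hX, hd b, sub_self]
  have hDval (e : ℂ ≃+* ℂ) (d : C) : D (e • d) = e (D d) := by
    simp only [D]
    rw [map_sub, hval, hval]
  have hDc : D c = X i (b • c) - X i c := by simp only [D]; rw [hX]
  have hDa (d : C) : D (a • d) = D d := by
    simp only [D]
    rw [hX, hcomm, hai, hai, hX]
  have hDb : D (b • c) = - D c := by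
    simp only [D]
    rw [hX, h.right, hX]
    ring
  have hDmov (d : C) (hd : d ∉ fixedPoints (ℂ ≃+* ℂ) C) : D d = D c ∨ D d = - D c := by
    rcases h.eq_of_notMem d hd with rfl | rfl | rfl | rfl
    · exact Or.inl rfl
    · exact Or.inl (hDa _)
    · exact Or.inr hDb
    · exact Or.inr ((hDa _).trans hDb)
  have hsum : ∑ g, D (p g) * D (ι • p g) = 2 * N := by
    have : ∑ g, D (p g) * D (ι • p g) =
        ∑ g, X (b • i) (p g) * X (b • i) (ι • p g) - ∑ g, X (b • i) (p g) * X i (ι • p g)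
          - ∑ g, X i (p g) * X (b • i) (ι • p g) + ∑ g, X i (p g) * X i (ι • p g) := by
      rw [← Finset.sum_sub_distrib, ← Finset.sum_sub_distrib, ← Finset.sum_add_distrib]
      exact Finset.sum_congr rfl fun g _ => by simp only [D]; ring
    rw [this, horth, horth, horth' _ _ hne, horth' _ _ hne.symm]
    ring
  -- The sign by which `ι`, complex conjugation in the application, acts on `D c`; it decides the
  -- sign in the conclusion.
  obtain ⟨ε, hε, hε'⟩ : ∃ ε : ℂ, (ε = 1 ∨ ε = -1) ∧ D (ι • c) = ε * D c := by
    rcases hDmov _ (orbit_subset_compl_fixedPoints h.notMem (mem_orbit c ι)) with h1 | h1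
    · exact ⟨1, Or.inl rfl, by rw [h1, one_mul]⟩
    · exact ⟨-1, Or.inr rfl, by rw [h1, neg_one_mul]⟩
  have hterm (d : C) : D d * D (ι • d) =
      if d ∉ fixedPoints (ℂ ≃+* ℂ) C then ε * D c ^ 2 else 0 := by
    by_cases hd : d ∈ fixedPoints (ℂ ≃+* ℂ) C
    · rw [hDfix d hd, zero_mul, if_neg (not_not.2 hd)]
    · rw [if_pos hd]
      rw [hDval] at hε' ⊢
      rcases hDmov d hd with h1 | h1
      · rw [h1, hε']; ring
      · rw [h1, map_neg, hε']; ring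
  simp_rw [hterm] at hsum
  rw [← Finset.sum_filter, Finset.sum_const, nsmul_eq_mul] at hsum
  refine ⟨D c, hDc ▸ hz0, by rw [← hDval, hDa], by rw [← hDval, hDb], ?_⟩
  rcases hε with rfl | rfl
  · left; rw [← hsum]; ring
  · right; rw [← hsum]; ring

theorem fixedPoints_ncard_eq_of_isKleinOrbit (hN : N ≠ 0)
    (hfix : ∀ a : ℂ ≃+* ℂ, (fixedBy C a).ncard = (fixedBy I a).ncard)
    {a b : ℂ ≃+* ℂ} {c : C} (h : IsKleinOrbit a b c) :
    (fixedPoints (ℂ ≃+* ℂ) C).ncard = (fixedPoints (ℂ ≃+* ℂ) I).ncard := by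
  classical
  by_contra hne
  have hex {a b : ℂ ≃+* ℂ} (h : IsKleinOrbit a b c) :
      ∃ i : I, a • i = i ∧ i ∉ fixedPoints (ℂ ≃+* ℂ) I := by
    by_contra! hcon
    refine hne ?_
    rw [← h.fixedBy_eq hcomm, hfix]
    exact congrArg Set.ncard (Set.Subset.antisymm (fun i hi => hcon i hi) fun i hi => hi a)
  have hab := (h.mul_left hcomm)
  obtain ⟨i₁, hi₁, hi₁'⟩ := hex h
  obtain ⟨i₂, hi₂, hi₂'⟩ := hex (h.swap hcomm)
  obtain ⟨i₃, hi₃, hi₃'⟩ := hex hab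
  obtain ⟨z₁, hz₁, ha₁, hb₁, hq₁⟩ := exists_eigenvalue_of_isKleinOrbit hcomm hX hval hinj p ι
    horth horth' h hi₁ hi₁'
  obtain ⟨z₂, hz₂, hb₂, ha₂, hq₂⟩ := exists_eigenvalue_of_isKleinOrbit hcomm hX hval hinj p ι
    horth horth' (h.swap hcomm) hi₂ hi₂'
  obtain ⟨z₃, hz₃, hab₃, hb₃, hq₃⟩ := exists_eigenvalue_of_isKleinOrbit hcomm hX hval hinj p ι
    horth horth' hab hi₃ hi₃'
  have ha₃ : a z₃ = -z₃ := by
    have : a (b z₃) = z₃ := hab₃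
    rw [hb₃, map_neg] at this
    exact neg_eq_iff_eq_neg.1 this
  have hM : ((Finset.univ.filter fun g => p g ∉ fixedPoints (ℂ ≃+* ℂ) C).card : ℂ) ≠ 0 := by
    intro h0
    rw [h0] at hq₁
    rcases hq₁ with h1 | h1 <;> simp [hN, eq_comm] at h1
  have hsep {x y : ℂ} (e : ℂ ≃+* ℂ) (hx0 : x ≠ 0) (hx : e x = x) (hy : e y = -y) : x ^ 2 ≠ y ^ 2 := by
    intro hxy
    rcases sq_eq_sq_iff_eq_or_eq_neg.1 hxy with rfl | rfl
    · rw [hx] at hy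
      exact hx0 (self_eq_neg.1 hy)
    · rw [map_neg, hy, neg_neg] at hx
      exact hx0 (by rw [neg_eq_zero]; exact self_eq_neg.1 hx)
  have h12 := hsep a hz₁ ha₁ ha₂
  have h13 := hsep a hz₁ ha₁ ha₃
  have h23 := hsep b hz₂ hb₂ hb₃
  have hcan {x y q : ℂ} (hxy : x ^ 2 ≠ y ^ 2)
      (hx : x ^ 2 * (Finset.univ.filter fun g => p g ∉ fixedPoints (ℂ ≃+* ℂ) C).card = q)
      (hy : y ^ 2 * (Finset.univ.filter fun g => p g ∉ fixedPoints (ℂ ≃+* ℂ) C).card = q) :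
      False := hxy (mul_right_cancel₀ hM (hx.trans hy.symm))
  -- Pigeonhole: two of the three squares share a sign, hence a value.
  rcases hq₁ with h1 | h1 <;> rcases hq₂ with h2 | h2 <;> rcases hq₃ with h3 | h3
  all_goals first
    | exact hcan h12 h1 h2
    | exact hcan h13 h1 h3
    | exact hcan h23 h2 h3

end Klein

namespace RatClass

/-! ### Galois action on conjugacy classes and irreducible characters -/

section Classes

variable {G : Type*} [Group G]

theorem pow_val_mul (u v : (ZMod (Nat.card G))ˣ) (g : G) :
    g ^ (u * v).val.val = (g ^ v.val.val) ^ u.val.val := by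
  rw [← pow_mul, Units.val_mul, ZMod.val_mul, mul_comm u.val.val, pow_mod_natCard]

/-- The power map induced by a unit on conjugacy classes. -/
noncomputable def powClass (u : (ZMod (Nat.card G))ˣ) : ConjClasses G → ConjClasses G :=
  Quotient.map (fun g => g ^ u.val.val) fun _ _ h => IsConj.pow _ h

@[simp]
theorem powClass_mk (u : (ZMod (Nat.card G))ˣ) (g : G) :
    powClass u (ConjClasses.mk g) = ConjClasses.mk (g ^ u.val.val) := rfl

variable [Finite G]

/-- The exponent by which an automorphism of `ℂ` acts on the `|G|`-th roots of unity. -/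
noncomputable def cyclotomicExponent (G : Type*) [Group G] [Finite G] :
    (ℂ ≃+* ℂ) →* (ZMod (Nat.card G))ˣ :=
  haveI : NeZero (Nat.card G) := ⟨Nat.card_pos.ne'⟩
  modularCyclotomicCharacter ℂ (n := Nat.card G) (HasEnoughRootsOfUnity.natCard_rootsOfUnity ℂ _)

theorem map_eq_pow_cyclotomicExponent (σ : ℂ ≃+* ℂ) {μ : ℂ} (hμ : μ ^ Nat.card G = 1) :
    σ μ = μ ^ (cyclotomicExponent G σ).val.val := by
  have : NeZero (Nat.card G) := ⟨Nat.card_pos.ne'⟩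
  have hu : IsUnit μ := IsUnit.of_pow_eq_one hμ Nat.card_pos.ne'
  obtain ⟨u, rfl⟩ := hu
  refine modularCyclotomicCharacter.spec ℂ
    (HasEnoughRootsOfUnity.natCard_rootsOfUnity ℂ (Nat.card G)) σ ?_
  rw [mem_rootsOfUnity]
  exact Units.ext (by simpa using hμ)

noncomputable instance : MulAction (ℂ ≃+* ℂ) (ConjClasses G) where
  smul σ c := powClass (cyclotomicExponent G σ) c
  one_smul c := by
    obtain ⟨g, rfl⟩ := ConjClasses.exists_rep c
    change powClass _ _ = _
    -- For trivial `G` the representative of `1` in `ZMod 1` is `0`, so the exponent is reduced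
    -- modulo `|G|`.
    rw [map_one, powClass_mk, Units.val_one, ZMod.val_one_eq_one_mod, pow_mod_natCard, pow_one]
  mul_smul σ τ c := by
    obtain ⟨g, rfl⟩ := ConjClasses.exists_rep c
    change powClass _ _ = powClass _ (powClass _ _)
    rw [map_mul, powClass_mk, powClass_mk, powClass_mk, pow_val_mul]

theorem smul_mk (σ : ℂ ≃+* ℂ) (g : G) :
    σ • ConjClasses.mk g = ConjClasses.mk (g ^ (cyclotomicExponent G σ).val.val) := rfl

theorem smul_smul_comm (σ τ : ℂ ≃+* ℂ) (c : ConjClasses G) : σ • τ • c = τ • σ • c := by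
  obtain ⟨g, rfl⟩ := ConjClasses.exists_rep c
  simp only [smul_mk, ← pow_val_mul, mul_comm]

end Classes

/-! ### The character table as a basis of class functions -/

section Characters

variable {G : Type*} [Group G]

noncomputable instance : MulAction (ℂ ≃+* ℂ) (Irr G) where
  smul σ χ := ⟨fun g => σ (χ.1 g), by
    obtain ⟨n, ρ, h, hχ⟩ := χ.2
    exact ⟨n, ρ.galoisTwist σ, h.galoisTwist σ, funext fun g => by
      rw [ρ.galoisTwist_character, hχ]⟩⟩
  one_smul _ := rfl
  mul_smul _ _ _ := rfl

theorem smul_apply (σ : ℂ ≃+* ℂ) (χ : Irr G) (g : G) : (σ • χ).1 g = σ (χ.1 g) := rfl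

theorem irr_conj (χ : Irr G) (g h : G) : χ.1 (h * g * h⁻¹) = χ.1 g := by
  obtain ⟨n, ρ, -, hχ⟩ := χ.2
  rw [hχ, ρ.char_conj]

/-- The character table. -/
def table (χ : Irr G) : ConjClasses G → ℂ :=
  Quotient.lift χ.1 fun g h hgh => by
    obtain ⟨c, rfl⟩ := isConj_iff.1 hgh
    exact (irr_conj χ g c).symm

@[simp]
theorem table_mk (χ : Irr G) (g : G) : table χ (ConjClasses.mk g) = χ.1 g := rfl

theorem table_injective : Function.Injective (table (G := G)) := fun _ _ h =>
  Subtype.ext (funext fun g => congrFun h (ConjClasses.mk g))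

variable [Finite G]

theorem map_table (σ : ℂ ≃+* ℂ) (χ : Irr G) (c : ConjClasses G) :
    σ (table χ c) = table χ (σ • c) := by
  obtain ⟨g, rfl⟩ := ConjClasses.exists_rep c
  obtain ⟨n, ρ, -, hχ⟩ := χ.2
  rw [smul_mk, table_mk, table_mk, hχ]
  exact ρ.map_character_eq_character_pow (σ : ℂ →+* ℂ)
    (fun μ hμ => map_eq_pow_cyclotomicExponent σ hμ) g

theorem table_smul (σ : ℂ ≃+* ℂ) (χ : Irr G) (c : ConjClasses G) :
    table (σ • χ) c = table χ (σ • c) := by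
  rw [← map_table]
  obtain ⟨g, rfl⟩ := ConjClasses.exists_rep c
  rfl

theorem irr_inv (χ : Irr G) (g : G) :
    χ.1 g⁻¹ = table χ (Complex.conjAe.toRingEquiv • ConjClasses.mk g) := by
  rw [← map_table, table_mk]
  obtain ⟨n, ρ, -, hχ⟩ := χ.2
  rw [hχ, ρ.character_inv]
  rfl

theorem isAlgebraic_irr (χ : Irr G) (g : G) : IsAlgebraic ℚ (χ.1 g) := by
  obtain ⟨n, ρ, -, hχ⟩ := χ.2
  rw [hχ]
  exact ρ.isAlgebraic_character g

-- Passes from isomorphism to equality of characters: non-isomorphic representations with equal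
-- characters would make the norm of `ρ.character` zero.
open scoped Classical in
theorem sum_character_mul_character_inv [Fintype G] {n m : ℕ}
    (ρ : Representation ℂ G (Fin n → ℂ)) (τ : Representation ℂ G (Fin m → ℂ))
    [ρ.IsIrreducible] [τ.IsIrreducible] :
    ∑ g, ρ.character g * τ.character g⁻¹ =
      if ρ.character = τ.character then (Nat.card G : ℂ) else 0 := by
  have hN : (Nat.card G : ℂ) ≠ 0 := by exact_mod_cast Nat.card_pos.ne'
  have := invertibleOfNonzero hN
  have h := Representation.char_orthonormal ρ τ
  rw [inv_mul_eq_iff_eq_mul₀ hN] at h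
  rw [h]
  by_cases hiso : Nonempty (τ.Equiv ρ)
  · rw [if_pos hiso, if_pos (Representation.char_iso hiso.some).symm, mul_one]
  · rw [if_neg hiso, mul_zero, if_neg]
    intro heq
    have h' := Representation.char_orthonormal ρ ρ
    rw [inv_mul_eq_iff_eq_mul₀ hN, if_pos ⟨.refl ρ⟩, mul_one] at h'
    rw [if_neg hiso, mul_zero, ← heq, h'] at h
    exact hN h

open scoped Classical in
theorem sum_irr_mul_irr_inv [Fintype G] (χ ψ : Irr G) :
    ∑ g, χ.1 g * ψ.1 g⁻¹ = if χ = ψ then (Nat.card G : ℂ) else 0 := by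
  obtain ⟨n, ρ, hρ, hχ⟩ := χ.2
  obtain ⟨m, τ, hτ, hψ⟩ := ψ.2
  simp only [Subtype.ext_iff, hχ, hψ, sum_character_mul_character_inv]

theorem linearIndependent_table : LinearIndependent ℂ (table (G := G)) := by
  classical
  have := Fintype.ofFinite G
  rw [linearIndependent_iff']
  intro s a hs χ hχ
  have hN : (Nat.card G : ℂ) ≠ 0 := by exact_mod_cast Nat.card_pos.ne'
  have h1 : ∑ g : G, (∑ ψ ∈ s, a ψ • table ψ) (ConjClasses.mk g) * χ.1 g⁻¹ = 0 := by
    rw [hs]; simp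
  simp only [Finset.sum_apply, Pi.smul_apply, table_mk, smul_eq_mul, Finset.sum_mul,
    mul_assoc] at h1
  rw [Finset.sum_comm] at h1
  simp only [← Finset.mul_sum, sum_irr_mul_irr_inv] at h1
  simpa [hχ, hN] using h1

instance : Finite (Irr G) := by
  have : Finite (ConjClasses G) := inferInstance
  exact (linearIndependent_table (G := G)).finite

theorem span_table : Submodule.span ℂ (Set.range (table (G := G))) = ⊤ := by
  classical
  have := Fintype.ofFinite G
  have := Fintype.ofFinite (Irr G)
  have hN : (Nat.card G : ℂ) ≠ 0 := by exact_mod_cast Nat.card_pos.ne'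
  rw [Submodule.eq_top_iff']
  intro f
  -- Fourier coefficients; the remainder `f'` is orthogonal to every irreducible character.
  let a (χ : Irr G) : ℂ := (Nat.card G : ℂ)⁻¹ * ∑ g, f (ConjClasses.mk g) * χ.1 g⁻¹
  let f' : ConjClasses G → ℂ := f - ∑ χ, a χ • table χ
  have hf' (ψ : Irr G) : ∑ g, f' (ConjClasses.mk g) * ψ.1 g⁻¹ = 0 := by
    simp only [f', Pi.sub_apply, Finset.sum_apply, Pi.smul_apply, table_mk, smul_eq_mul,
      sub_mul, Finset.sum_mul, Finset.sum_sub_distrib, mul_assoc]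
    rw [Finset.sum_comm (γ := G)]
    simp only [← Finset.mul_sum, sum_irr_mul_irr_inv]
    simp only [mul_ite, mul_zero, Finset.sum_ite_eq', Finset.mem_univ, if_true, a]
    field_simp
    ring
  -- Inversion is inserted because the completeness criterion pairs with `χ(g)`, not `χ(g⁻¹)`.
  have h0 : (fun g : G => f' (ConjClasses.mk g⁻¹)) = 0 := by
    refine Representation.eq_zero_of_forall_irreducible (fun g h => ?_) fun n ρ hρ => ?_
    · refine congrArg f' (ConjClasses.mk_eq_mk_iff_isConj.2 (isConj_iff.2 ⟨h⁻¹, by group⟩))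
    · rw [← hf' ⟨ρ.character, n, ρ, hρ, rfl⟩]
      exact Fintype.sum_equiv (Equiv.inv G) _ _ fun g => by simp
  have h1 : f' = 0 := by
    ext c
    obtain ⟨g, rfl⟩ := ConjClasses.exists_rep c
    simpa using congrFun h0 g⁻¹
  rw [sub_eq_zero.1 h1]
  exact Submodule.sum_mem _ fun χ _ => Submodule.smul_mem _ _ (Submodule.subset_span ⟨χ, rfl⟩)

/-- The irreducible characters form a basis of the space of class functions. -/
noncomputable def tableBasis (G : Type*) [Group G] [Finite G] :
    Module.Basis (Irr G) ℂ (ConjClasses G → ℂ) :=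
  Module.Basis.mk linearIndependent_table span_table.ge

@[simp]
theorem tableBasis_apply (χ : Irr G) : tableBasis G χ = table χ := by
  rw [tableBasis, Module.Basis.mk_apply]

/-- Evaluations at `c` and `d` agree on a basis, hence on the indicator function of `d`. -/
theorem eq_of_forall_table_eq {c d : ConjClasses G} (h : ∀ χ : Irr G, table χ c = table χ d) :
    c = d := by
  classical
  have h1 : (LinearMap.proj c : (ConjClasses G → ℂ) →ₗ[ℂ] ℂ) = LinearMap.proj d :=
    (tableBasis G).ext fun χ => by simpa using h χ
  have h2 := LinearMap.congr_fun h1 (Pi.single d 1)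
  by_contra hne
  simp [hne] at h2

end Characters

/-! ### Rationality as invariance under automorphisms of `ℂ` -/

section Rationality

variable {G : Type*} [Group G] [Finite G]

theorem forall_ringEquiv_iff_mem_bot {z : ℂ} (hz : IsAlgebraic ℚ z) :
    (∀ σ : ℂ ≃+* ℂ, σ z = z) ↔ z ∈ (⊥ : IntermediateField ℚ ℂ) := by
  refine ⟨Complex.mem_bot_of_forall_ringEquiv_eq hz, fun h σ => ?_⟩
  obtain ⟨q, rfl⟩ := IntermediateField.mem_bot.1 h
  simp

theorem isRationalElement_iff (g : G) :
    IsRationalElement g ↔ ConjClasses.mk g ∈ fixedPoints (ℂ ≃+* ℂ) (ConjClasses G) := by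
  rw [IsRationalElement, elementField, IntermediateField.adjoin_eq_bot_iff, mem_fixedPoints]
  constructor
  · intro h σ
    refine eq_of_forall_table_eq fun χ => ?_
    rw [← map_table, table_mk]
    exact (forall_ringEquiv_iff_mem_bot (isAlgebraic_irr χ g)).2 (h ⟨χ.1, χ.2, rfl⟩) σ
  · rintro h _ ⟨ψ, hψ, rfl⟩
    refine (forall_ringEquiv_iff_mem_bot (isAlgebraic_irr ⟨ψ, hψ⟩ g)).1 fun σ => ?_
    have := map_table σ ⟨ψ, hψ⟩ (ConjClasses.mk g)
    rwa [h σ, table_mk] at this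

theorem characterField_eq_bot_iff (χ : Irr G) :
    characterField χ.1 = ⊥ ↔ χ ∈ fixedPoints (ℂ ≃+* ℂ) (Irr G) := by
  rw [characterField, IntermediateField.adjoin_eq_bot_iff, mem_fixedPoints]
  constructor
  · intro h σ
    refine Subtype.ext (funext fun g => ?_)
    exact (forall_ringEquiv_iff_mem_bot (isAlgebraic_irr χ g)).2 (h ⟨g, rfl⟩) σ
  · rintro h _ ⟨g, rfl⟩
    refine (forall_ringEquiv_iff_mem_bot (isAlgebraic_irr χ g)).1 fun σ => ?_
    rw [← smul_apply, h σ]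

theorem rationalClasses_eq :
    rationalClasses G = fixedPoints (ℂ ≃+* ℂ) (ConjClasses G) := by
  ext c
  obtain ⟨g, rfl⟩ := ConjClasses.exists_rep c
  refine ⟨fun h => (isRationalElement_iff g).1 (h g ConjClasses.mem_carrier_mk), fun h x hx => ?_⟩
  rw [isRationalElement_iff, ConjClasses.mem_carrier_iff_mk_eq.1 hx]
  exact h

theorem irrationalClasses_eq :
    irrationalClasses G = (fixedPoints (ℂ ≃+* ℂ) (ConjClasses G))ᶜ := by
  ext c
  obtain ⟨g, rfl⟩ := ConjClasses.exists_rep c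
  refine ⟨fun h h' => h g ConjClasses.mem_carrier_mk ((isRationalElement_iff g).2 h'),
    fun h x hx => ?_⟩
  rw [isRationalElement_iff, ConjClasses.mem_carrier_iff_mk_eq.1 hx]
  exact h

theorem rationalIrr_eq :
    rationalIrr G = Subtype.val '' fixedPoints (ℂ ≃+* ℂ) (Irr G) := by
  ext χ
  constructor
  · rintro ⟨h, h'⟩
    exact ⟨⟨χ, h⟩, (characterField_eq_bot_iff ⟨χ, h⟩).1 h', rfl⟩
  · rintro ⟨χ, h, rfl⟩
    exact ⟨χ.2, (characterField_eq_bot_iff χ).2 h⟩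

end Rationality

end RatClass

theorem theoremA (G : Type*) [Group G] [Finite G]
    (h : (RatClass.irrationalClasses G).encard ≤ 5) :
    (RatClass.rationalClasses G).encard = (RatClass.rationalIrr G).encard := by
  have := Fintype.ofFinite G
  rw [RatClass.rationalClasses_eq, RatClass.rationalIrr_eq,
    Subtype.val_injective.injOn.encard_image, ← (Set.toFinite _).cast_ncard_eq,
    ← (Set.toFinite _).cast_ncard_eq]
  rw [RatClass.irrationalClasses_eq, ← (Set.toFinite _).cast_ncard_eq] at h
  have hfix := ncard_fixedBy_eq_of_basis (A := ℂ ≃+* ℂ) (RatClass.tableBasis G)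
    (by simpa using RatClass.table_smul)
  congr 1
  rcases exists_zpow_smul_or_isKleinOrbit RatClass.smul_smul_comm (by exact_mod_cast h) with
    ⟨a, ha⟩ | ⟨a, b, c, hk⟩
  · rw [fixedPoints_eq_fixedBy_of_forall_zpow ha,
      fixedPoints_eq_fixedBy_table RatClass.table_smul RatClass.table_injective ha, hfix]
  · classical
    -- Complex conjugation acts on classes as inversion, so the orthogonality relations take the
    -- form required with `ι` and `N = |G|`.
    refine fixedPoints_ncard_eq_of_isKleinOrbit RatClass.smul_smul_comm RatClass.table_smul
      RatClass.map_table RatClass.table_injective ConjClasses.mk (N := Nat.card G)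
      Complex.conjAe.toRingEquiv (fun χ => ?_) (fun χ ψ hne => ?_)
      (by exact_mod_cast Nat.card_pos.ne') hfix hk
    · simp_rw [← RatClass.irr_inv, RatClass.table_mk]
      rw [RatClass.sum_irr_mul_irr_inv, if_pos rfl]
    · simp_rw [← RatClass.irr_inv, RatClass.table_mk]
      rw [RatClass.sum_irr_mul_irr_inv, if_neg hne]
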